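/- Let $\Bbbk$ be a field. A bicomplex $M$ over $\Bbbk$ is a family of $\Bbbk$-vector spaces $M^{i,j}$ ($i,j\in\mathbb Z$; no finite-dimensionality assumed) with linear maps $\partial_1\colon M^{i,j}\to M^{i+1,j}$ and $\partial_2\colon M^{i,j}\to M^{i,j+1}$ such that $\partial_1^2=0$, $\partial_2^2=0$, $\partial_1\partial_2+\partial_2\partial_1=0$. Its total complex is $\mathrm{Tot}^n(M)=\bigoplus_{i+j=n}M^{i,j}$ with differential $d=\partial_1+\partial_2$, and its total cohomology is $H^n(\mathrm{Tot}(M))$. Call $M$ bounded from the Southeast if there are $a,b\in\mathbb Z$ with $M^{i,j}=0$ whenever $i\ge a$ and $j\le b$, and bounded from the Northwest if there are $a,b\in\mathbb Z$ with $M^{i,j}=0$ whenever $i\le a$ and $j\ge b$. For $p\in\mathbb Z$ let $F^p_{\mathrm{col}}H^n(\mathrm{Tot}(M))$ (respectively $F^p_{\mathrm{row}}H^n(\mathrm{Tot}(M))$) be the space of classes of cocycles lying in $\bigoplus_{i+j=n,\ i\ge p}M^{i,j}$ (respectively in $\bigoplus_{i+j=n,\ j\ge p}M^{i,j}$). (1)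 If $M$ is bounded from the Southeast, there is a spectral sequence $(E_r^{i,j},d_r)_{r\ge 1}$ of $\Bbbk$-vector spaces, with $d_r\colon E_r^{i,j}\to E_r^{i+r,\,j-r+1}$, whose first page is isomorphic to $(H(M,\partial_2),\partial_1)$, i.e. $E_1^{i,j}\cong H^{i,j}(M,\partial_2)$ with $d_1$ corresponding to the map induced by $\partial_1$, and which converges to the total cohomology of $M$ with the filtration $F_{\mathrm{col}}$: $E_\infty^{i,j}\cong F^i_{\mathrm{col}}H^{i+j}(\mathrm{Tot}(M))/F^{i+1}_{\mathrm{col}}H^{i+j}(\mathrm{Tot}(M))$ for all $i,j$. (2) If $M$ is bounded from the Northwest, there is a spectral sequence $(E_r^{i,j},d_r)_{r\ge 1}$ of $\Bbbk$-vector spaces, with $d_r\colon E_r^{i,j}\to E_r^{i-r+1,\,j+r}$, whose first page is isomorphic to $(H(M,\partial_1),\partial_2)$, and which converges to the total cohomology of $M$ with the filtration $F_{\mathrm{row}}$: $E_\infty^{i,j}\cong F^j_{\mathrm{row}}H^{i+j}(\mathrm{Tot}(M))/F^{j+1}_{\mathrm{row}}H^{i+j}(\mathrm{Tot}(M))$ for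 all $i,j$. Here $E_\infty^{i,j}=Z_\infty^{i,j}/B_\infty^{i,j}$, where $Z_\infty^{i,j}\subseteq E_1^{i,j}$ consists of the elements that survive to every page and $B_\infty^{i,j}$ of those that survive to some page and become zero there. Convergence includes that, for each $(i,j)$, the differential $d_r$ leaving $E_r^{i,j}$ vanishes for all sufficiently large $r$, and that for each $n$ the filtration $F^\bullet H^n(\mathrm{Tot}(M))$ is decreasing, has union $H^n(\mathrm{Tot}(M))$, and satisfies $F^pH^n(\mathrm{Tot}(M))=0$ for some $p$. -/

import Mathlib

open CategoryTheory
open scoped DirectSum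

universe u v

noncomputable section

/-- A bicomplex of `k`-vector spaces: spaces `X i j` for `i j : ℤ`, with anticommuting differentials
`∂₁ : X i j ⟶ X (i+1) j` and `∂₂ : X i j ⟶ X i (j+1)`. The target index is a separate variable with
an equation (`i + 1 = i'`), which is the same data and avoids transports along equalities. -/
structure Bicomplex (k : Type u) [Field k] where
  X : ℤ → ℤ → ModuleCat.{v} k
  d₁ : ∀ i i' j : ℤ, i + 1 = i' → (X i j ⟶ X i' j)
  d₂ : ∀ i j j' : ℤ, j + 1 = j' → (X i j ⟶ X i j')
  d₁_d₁ : ∀ (i i' i'' j : ℤ) (h : i + 1 = i') (h' : i' + 1 = i''),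
    d₁ i i' j h ≫ d₁ i' i'' j h' = 0
  d₂_d₂ : ∀ (i j j' j'' : ℤ) (h : j + 1 = j') (h' : j' + 1 = j''),
    d₂ i j j' h ≫ d₂ i j' j'' h' = 0
  anticomm : ∀ (i i' j j' : ℤ) (h : i + 1 = i') (h' : j + 1 = j'),
    d₂ i j j' h' ≫ d₁ i i' j' h + d₁ i i' j h ≫ d₂ i' j j' h' = 0

namespace Bicomplex

variable {k : Type u} [Field k] (M : Bicomplex.{u, v} k)

/-- `M^{i,j} = 0` whenever `i ≫ 0` and `j ≪ 0`. -/
def BoundedFromSoutheast : Prop :=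
  ∃ a b : ℤ, ∀ i j : ℤ, a ≤ i → j ≤ b → Subsingleton (M.X i j)

/-- `M^{i,j} = 0` whenever `i ≪ 0` and `j ≫ 0`. -/
def BoundedFromNorthwest : Prop :=
  ∃ a b : ℤ, ∀ i j : ℤ, i ≤ a → b ≤ j → Subsingleton (M.X i j)

/-! ### Cohomology with respect to one differential -/

/-- `M^{i,j-1} ⟶ M^{i,j} ⟶ M^{i,j+1}` with the maps `∂₂`. -/
def sc₂ (i j : ℤ) : ShortComplex (ModuleCat.{v} k) :=
  ShortComplex.mk (M.d₂ i (j - 1) j (by lia)) (M.d₂ i j (j + 1) rfl) (M.d₂_d₂ _ _ _ _ _ _)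

/-- `M^{i-1,j} ⟶ M^{i,j} ⟶ M^{i+1,j}` with the maps `∂₁`. -/
def sc₁ (i j : ℤ) : ShortComplex (ModuleCat.{v} k) :=
  ShortComplex.mk (M.d₁ (i - 1) i j (by lia)) (M.d₁ i (i + 1) j rfl) (M.d₁_d₁ _ _ _ _ _ _)

/-- `H^{i,j}(M, ∂₂)`. -/
def H₂ (i j : ℤ) : ModuleCat.{v} k := (M.sc₂ i j).homology

/-- `H^{i,j}(M, ∂₁)`. -/
def H₁ (i j : ℤ) : ModuleCat.{v} k := (M.sc₁ i j).homology

/-- `∂₁` in the middle; the outer signs account for the anticommutation. -/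
def sc₂Map (i j : ℤ) : M.sc₂ i j ⟶ M.sc₂ (i + 1) j where
  τ₁ := -M.d₁ i (i + 1) (j - 1) rfl
  τ₂ := M.d₁ i (i + 1) j rfl
  τ₃ := -M.d₁ i (i + 1) (j + 1) rfl
  comm₁₂ := by
    have h := M.anticomm i (i + 1) (j - 1) j rfl (by lia)
    simpa [sc₂] using (eq_neg_of_add_eq_zero_left h).symm
  comm₂₃ := by
    have h := M.anticomm i (i + 1) j (j + 1) rfl rfl
    simpa [sc₂] using eq_neg_of_add_eq_zero_right h

/-- `∂₂` in the middle; the outer signs account for the anticommutation. -/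
def sc₁Map (i j : ℤ) : M.sc₁ i j ⟶ M.sc₁ i (j + 1) where
  τ₁ := -M.d₂ (i - 1) j (j + 1) rfl
  τ₂ := M.d₂ i j (j + 1) rfl
  τ₃ := -M.d₂ (i + 1) j (j + 1) rfl
  comm₁₂ := by
    have h := M.anticomm (i - 1) i j (j + 1) (by lia) rfl
    simpa [sc₁] using (eq_neg_of_add_eq_zero_right h).symm
  comm₂₃ := by
    have h := M.anticomm i (i + 1) j (j + 1) rfl rfl
    simpa [sc₁] using eq_neg_of_add_eq_zero_left h

/-- The map `H^{i,j}(M, ∂₂) ⟶ H^{i+1,j}(M, ∂₂)` induced by `∂₁`. -/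
def inducedD₁ (i j : ℤ) : M.H₂ i j ⟶ M.H₂ (i + 1) j :=
  ShortComplex.homologyMap (M.sc₂Map i j)

/-- The map `H^{i,j}(M, ∂₁) ⟶ H^{i,j+1}(M, ∂₁)` induced by `∂₂`. -/
def inducedD₂ (i j : ℤ) : M.H₁ i j ⟶ M.H₁ i (j + 1) :=
  ShortComplex.homologyMap (M.sc₁Map i j)

/-! ### The total complex -/

/-- `Tot^n(M)`, the direct sum of the `M^{i,j}` with `i + j = n`. -/
abbrev Tot (n : ℤ) : Type v :=
  ⨁ x : {x : ℤ × ℤ // x.1 + x.2 = n}, M.X x.1.1 x.1.2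

/-- The inclusion of the summand `M^{i,j}` in `Tot^n(M)`, where `i + j = n`. -/
def ιTot (i j n : ℤ) (h : i + j = n) : M.X i j →ₗ[k] M.Tot n :=
  DirectSum.lof k {x : ℤ × ℤ // x.1 + x.2 = n} (fun x => M.X x.1.1 x.1.2) ⟨(i, j), h⟩

/-- The total differential `∂₁ + ∂₂`. -/
def totD (n n' : ℤ) (h : n + 1 = n') : M.Tot n →ₗ[k] M.Tot n' :=
  DirectSum.toModule k _ _ fun x =>
    M.ιTot (x.1.1 + 1) x.1.2 n' (by have := x.2; lia) ∘ₗ (M.d₁ x.1.1 (x.1.1 + 1) x.1.2 rfl).hom +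
    M.ιTot x.1.1 (x.1.2 + 1) n' (by have := x.2; lia) ∘ₗ (M.d₂ x.1.1 x.1.2 (x.1.2 + 1) rfl).hom

lemma totD_ιTot (i j n n' : ℤ) (h : i + j = n) (h' : n + 1 = n') (m : M.X i j) :
    M.totD n n' h' (M.ιTot i j n h m) =
      M.ιTot (i + 1) j n' (by lia) ((M.d₁ i (i + 1) j rfl).hom m) +
      M.ιTot i (j + 1) n' (by lia) ((M.d₂ i j (j + 1) rfl).hom m) := by
  simp only [totD, ιTot, DirectSum.toModule_lof]
  rfl

lemma totD_totD (n n' n'' : ℤ) (h : n + 1 = n') (h' : n' + 1 = n'') :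
    M.totD n' n'' h' ∘ₗ M.totD n n' h = 0 := by
  apply DirectSum.linearMap_ext
  rintro ⟨⟨i, j⟩, hij⟩
  refine LinearMap.ext fun m => ?_
  change M.totD n' n'' h' (M.totD n n' h (M.ιTot i j n hij m)) = 0
  have e₁ := congrArg (fun f => f.hom m) (M.d₁_d₁ i (i + 1) (i + 1 + 1) j rfl rfl)
  have e₂ := congrArg (fun f => f.hom m) (M.d₂_d₂ i j (j + 1) (j + 1 + 1) rfl rfl)
  have e₃ := congrArg (fun f => f.hom m) (M.anticomm i (i + 1) j (j + 1) rfl rfl)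
  simp only [ModuleCat.hom_comp, ModuleCat.hom_add, ModuleCat.hom_zero, LinearMap.comp_apply,
    LinearMap.add_apply, LinearMap.zero_apply] at e₁ e₂ e₃
  rw [totD_ιTot, map_add, totD_ιTot, totD_ιTot, e₁, e₂, map_zero, map_zero, zero_add, add_zero,
    ← map_add, (add_comm _ _).trans e₃, map_zero]

/-- The total complex `(Tot(M), ∂₁ + ∂₂)`. -/
def total : CochainComplex (ModuleCat.{v} k) ℤ where
  X n := ModuleCat.of k (M.Tot n)
  d n n' := if h : n + 1 = n' then ModuleCat.ofHom (M.totD n n' h) else 0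
  shape n n' h := dif_neg h
  d_comp_d' n n' n'' h h' := by
    obtain rfl : n + 1 = n' := h
    obtain rfl : n + 1 + 1 = n'' := h'
    rw [dif_pos rfl, dif_pos rfl, ← ModuleCat.ofHom_comp, totD_totD]
    rfl

/-- The total cohomology `H^n(Tot(M), ∂₁ + ∂₂)`. -/
def totalCohomology (n : ℤ) : ModuleCat.{v} k := M.total.homology n

/-- The elements of `Tot^n(M)` all of whose components outside `S` vanish. -/
def supportedIn (S : Set (ℤ × ℤ)) (n : ℤ) : Submodule k (M.total.X n) where
  carrier := {t | ∀ x : {x : ℤ × ℤ // x.1 + x.2 = n}, x.1 ∉ S → (show M.Tot n from t) x = 0}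
  zero_mem' _ _ := rfl
  add_mem' {a b} ha hb x hx := by
    change (show M.Tot n from a) x + (show M.Tot n from b) x = 0
    rw [ha x hx, hb x hx, add_zero]
  smul_mem' c a ha x hx := by
    change c • (show M.Tot n from a) x = 0
    rw [ha x hx, smul_zero]

/-- The classes in `H^n(Tot(M))` that are represented by a cocycle supported in `S`. -/
def classesSupportedIn (S : Set (ℤ × ℤ)) (n : ℤ) : Submodule k (M.totalCohomology n) :=
  ((M.supportedIn S n).comap (M.total.iCycles n).hom).map (M.total.homologyπ n).hom

/-- The filtration of `H^n(Tot(M))` by columns: the classes of cocycles in `⨁_{i ≥ p} M^{i,n-i}`. -/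
def columnFiltration (p n : ℤ) : Submodule k (M.totalCohomology n) :=
  M.classesSupportedIn {x | p ≤ x.1} n

/-- The filtration of `H^n(Tot(M))` by rows: the classes of cocycles in `⨁_{j ≥ p} M^{n-j,j}`. -/
def rowFiltration (p n : ℤ) : Submodule k (M.totalCohomology n) :=
  M.classesSupportedIn {x | p ≤ x.2} n

end Bicomplex

/-! ### The limit page and convergence of a spectral sequence of vector spaces -/

namespace SpecSeq

variable {k : Type u} [Field k] {κ : Type} {c : ℤ → ComplexShape κ} {r₀ : ℤ}
  (E : SpectralSequence (ModuleCat.{v} k) c r₀)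

/-- For a subspace `S` of `E_{r+1}` at `x`, the subspace of `E_r` at `x` that consists of the
elements killed by the differential of `E_r` and whose class in `E_{r+1}` lies in `S`. -/
def pullback (x : κ) (r : ℤ) (hr : r₀ ≤ r)
    (S : Submodule k ((E.page (r + 1) (by lia)).X x)) : Submodule k ((E.page r hr).X x) :=
  (S.comap ((E.page r hr).homologyπ x ≫ (E.iso r (r + 1) x rfl hr).hom).hom).map
    ((E.page r hr).iCycles x).hom

/-- The subspace of `E_r` of the elements that survive to `E_{r+n}`. -/
def surviving (x : κ) : ∀ (_ : ℕ) (r : ℤ) (hr : r₀ ≤ r), Submodule k ((E.page r hr).X x)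
  | 0, _, _ => ⊤
  | n + 1, r, hr => pullback E x r hr (surviving x n (r + 1) (by lia))

/-- The subspace of `E_r` of the elements that survive to `E_{r+n}` and become zero there. -/
def dying (x : κ) : ∀ (_ : ℕ) (r : ℤ) (hr : r₀ ≤ r), Submodule k ((E.page r hr).X x)
  | 0, _, _ => ⊥
  | n + 1, r, hr => pullback E x r hr (dying x n (r + 1) (by lia))

/-- The permanent cycles `Z_∞ = ⋂ Z_r` in the first page. -/
def permanentCycles (x : κ) : Submodule k ((E.page r₀ le_rfl).X x) :=
  ⨅ n : ℕ, surviving E x n r₀ le_rfl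

/-- The eventual boundaries `B_∞ = ⋃ B_r` in the first page (an increasing union). -/
def eventualBoundaries (x : κ) : Submodule k ((E.page r₀ le_rfl).X x) :=
  ⨆ n : ℕ, dying E x n r₀ le_rfl

/-- `E_∞ = Z_∞ / B_∞`. -/
abbrev EInfty (x : κ) : Type v :=
  permanentCycles E x ⧸ (eventualBoundaries E x).submoduleOf (permanentCycles E x)

/-- The associated graded piece `F^p H^n / F^{p+1} H^n` of a decreasing filtration. -/
abbrev gr {H : ℤ → ModuleCat.{v} k} (F : ∀ _ n : ℤ, Submodule k (H n)) (p n : ℤ) : Type v :=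
  F p n ⧸ (F (p + 1) n).submoduleOf (F p n)

/-- Convergence of a spectral sequence to a graded space `H` with filtration `F`. Here `fil x` and
`deg x` are the filtration degree and the total degree of the position `x`. -/
structure ConvergesTo (fil deg : κ → ℤ) (H : ℤ → ModuleCat.{v} k)
    (F : ∀ _ n : ℤ, Submodule k (H n)) : Prop where
  /-- For each position, the differentials that leave it vanish on all sufficiently late pages. -/
  regular : ∀ x, ∃ R : ℤ, ∀ (r : ℤ) (hr : r₀ ≤ r), R ≤ r → ∀ y, (E.page r hr).d x y = 0
  decreasing : ∀ p n, F (p + 1) n ≤ F p n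
  exhaustive : ∀ n, ⨆ p, F p n = ⊤
  /-- In each degree the filtration reaches zero; so it is Hausdorff and complete. -/
  terminates : ∀ n, ∃ p, F p n = ⊥
  /-- `E_∞` is the associated graded space of the filtration. -/
  limit : ∀ x, Nonempty (EInfty E x ≃ₗ[k] gr F (fil x) (deg x))

end SpecSeq

end

/-!
Filter `Tot(M)` by the column index for (1), by the row index for (2). The spectral sequence of a
filtered complex has `Z_r^p = {a ∈ F^p | d a ∈ F^{p+r}}` and
`E_r^p = Z_r^p / (Z_r^p ∩ (F^{p+1} + d F^{p-r+1}))`. In each total degree there is exactly one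
position of a given column (or row), so `F^p / F^{p+1}` is the `p`-th column (or row) of `M`, and
`E_1` is its homology.

The boundedness makes the filtration zero in each total degree from some index on, so an element
that survives long enough is represented by a cocycle of `F^p`. Elements of a direct sum have
finite support, so every cochain lies in some `F^q`, and a class dies eventually exactly when it
is represented by a coboundary modulo `F^{p+1}`. Hence the cocycles of `F^p` present both `E_∞`
and the associated graded space of the cohomology, with the same kernel.
-/

/-! ### Homology of short complexes of modules -/

section Homology

variable {R : Type u} [Ring R]

/-- Two quotient maps of a module with the same kernel have isomorphic targets. -/
noncomputable def linearEquivOfKerEq {A B C : Type*} [AddCommGroup A] [Module R A]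
    [AddCommGroup B] [Module R B] [AddCommGroup C] [Module R C] (f : A →ₗ[R] B) (g : A →ₗ[R] C)
    (hf : Function.Surjective f) (hg : Function.Surjective g)
    (h : LinearMap.ker f = LinearMap.ker g) : B ≃ₗ[R] C :=
  (f.quotKerEquivOfSurjective hf).symm ≪≫ₗ Submodule.quotEquivOfEq _ _ h ≪≫ₗ
    g.quotKerEquivOfSurjective hg

lemma linearEquivOfKerEq_apply {A B C : Type*} [AddCommGroup A] [Module R A]
    [AddCommGroup B] [Module R B] [AddCommGroup C] [Module R C] (f : A →ₗ[R] B) (g : A →ₗ[R] C)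
    (hf : Function.Surjective f) (hg : Function.Surjective g)
    (h : LinearMap.ker f = LinearMap.ker g) (a : A) :
    linearEquivOfKerEq f g hf hg h (f a) = g a := by
  have : (f.quotKerEquivOfSurjective hf).symm (f a) = Submodule.Quotient.mk a := by
    rw [LinearEquiv.symm_apply_eq]; rfl
  simp only [linearEquivOfKerEq, LinearEquiv.trans_apply, this]
  rfl

variable (S : ShortComplex (ModuleCat.{v} R))

lemma moduleCat_homologyπ_surjective : Function.Surjective S.homologyπ :=
  (ModuleCat.epi_iff_surjective _).1 inferInstance

lemma moduleCat_homologyπ_eq_zero_iff (c : S.cycles) :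
    S.homologyπ c = 0 ↔ S.iCycles c ∈ LinearMap.range S.f.hom := by
  have hι : Function.Injective S.homologyι := (ModuleCat.mono_iff_injective _).1 inferInstance
  rw [← S.moduleCat_pOpcycles_eq_zero_iff, ← ConcreteCategory.comp_apply, ← S.homology_π_ι,
    ConcreteCategory.comp_apply, map_eq_zero_iff _ hι]

lemma moduleCat_iCycles_injective : Function.Injective S.iCycles :=
  (ModuleCat.mono_iff_injective _).1 inferInstance

lemma moduleCat_range_iCycles : LinearMap.range S.iCycles.hom = LinearMap.ker S.g.hom := by
  apply le_antisymm
  · rintro _ ⟨c, rfl⟩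
    exact congr($(S.iCycles_g) c)
  · exact fun m hm => ⟨S.moduleCatCyclesIso.inv ⟨m, hm⟩,
      congr($(S.moduleCatCyclesIso_inv_iCycles) ⟨m, hm⟩)⟩

variable {A : Type v} [AddCommGroup A] [Module R A] {N : ModuleCat.{v} R}

/-- The lift to `S.cycles` of a linear map with values in `ker S.g`. -/
noncomputable def moduleCatCyclesLift (a : A →ₗ[R] S.X₂)
    (ha : ∀ z, a z ∈ LinearMap.ker S.g.hom) : A →ₗ[R] S.cycles :=
  S.moduleCatCyclesIso.inv.hom ∘ₗ a.codRestrict (LinearMap.ker S.g.hom) ha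

lemma iCycles_moduleCatCyclesLift (a : A →ₗ[R] S.X₂) (ha : ∀ z, a z ∈ LinearMap.ker S.g.hom)
    (z : A) : S.iCycles (moduleCatCyclesLift S a ha z) = a z :=
  congr($(S.moduleCatCyclesIso_inv_iCycles) ⟨a z, ha z⟩)

/-- The homology of `S` computed by a presentation: `a` maps `A` onto the cycles, and `q` is a
quotient map of `A` that kills exactly the preimage of the boundaries. -/
noncomputable def homologyIsoOfPresentation (a : A →ₗ[R] S.X₂) (q : A →ₗ[R] N)
    (ha : LinearMap.range a = LinearMap.ker S.g.hom) (hq : Function.Surjective q)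
    (haq : ∀ z, a z ∈ LinearMap.range S.f.hom ↔ q z = 0) : S.homology ≅ N :=
  (linearEquivOfKerEq
    (S.homologyπ.hom ∘ₗ moduleCatCyclesLift S a fun z => ha ▸ LinearMap.mem_range_self a z) q
    (by
      refine (moduleCat_homologyπ_surjective S).comp fun c => ?_
      obtain ⟨z, hz⟩ : S.iCycles c ∈ LinearMap.range a := by
        rw [ha, ← moduleCat_range_iCycles]
        exact ⟨c, rfl⟩
      exact ⟨z, moduleCat_iCycles_injective S ((iCycles_moduleCatCyclesLift S a _ z).trans hz)⟩)
    hq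
    (by
      ext z
      rw [LinearMap.mem_ker, LinearMap.mem_ker, ← haq, LinearMap.comp_apply]
      refine (moduleCat_homologyπ_eq_zero_iff S _).trans ?_
      rw [iCycles_moduleCatCyclesLift])).toModuleIso

lemma homologyIsoOfPresentation_hom_homologyπ {a : A →ₗ[R] S.X₂} {q : A →ₗ[R] N}
    (ha : LinearMap.range a = LinearMap.ker S.g.hom) (hq : Function.Surjective q)
    (haq : ∀ z, a z ∈ LinearMap.range S.f.hom ↔ q z = 0) {c : S.cycles} {z : A}
    (h : S.iCycles c = a z) :
    (homologyIsoOfPresentation S a q ha hq haq).hom (S.homologyπ c) = q z := by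
  obtain rfl : moduleCatCyclesLift S a (fun z => ha ▸ LinearMap.mem_range_self a z) z = c :=
    moduleCat_iCycles_injective S ((iCycles_moduleCatCyclesLift S a _ z).trans h.symm)
  exact linearEquivOfKerEq_apply _ _ _ _ _ z

end Homology

section Cochains

variable {R : Type u} [Ring R] (K : CochainComplex (ModuleCat.{v} R) ℤ)

lemma cochain_d_d (n m l : ℤ) (a : K.X n) : K.d m l (K.d n m a) = 0 :=
  congr($(K.d_comp_d n m l) a)

variable {K} {n : ℤ}

lemma cochain_homologyπ_eq_zero_iff (c : K.cycles n) :
    K.homologyπ n c = 0 ↔ ∃ w, K.d (n - 1) n w = K.iCycles n c := by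
  rw [← CochainComplex.prev ℤ n]
  exact moduleCat_homologyπ_eq_zero_iff (K.sc n) c

lemma exists_cochain_iCycles_eq {a : K.X n} (ha : K.d n (n + 1) a = 0) :
    ∃ c, K.iCycles n c = a := by
  rw [← CochainComplex.next ℤ n] at ha
  exact (moduleCat_range_iCycles (K.sc n)).ge ha

lemma cochain_d_iCycles {m : ℤ} (c : K.cycles n) : K.d n m (K.iCycles n c) = 0 :=
  congr($(K.iCycles_d n m) c)

end Cochains

lemma SpecSeq.nonempty_eInfty_equiv {k : Type u} [Field k] {κ : Type} {c : ℤ → ComplexShape κ}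
    {r₀ : ℤ} (E : SpectralSequence (ModuleCat.{v} k) c r₀) (x : κ) {A N : Type v}
    [AddCommGroup A] [Module k A] [AddCommGroup N] [Module k N]
    (g : A →ₗ[k] (E.page r₀ le_rfl).X x) (hg : LinearMap.range g = permanentCycles E x)
    {h : A →ₗ[k] N} (hh : Function.Surjective h)
    (hgh : ∀ a, g a ∈ eventualBoundaries E x ↔ h a = 0) : Nonempty (EInfty E x ≃ₗ[k] N) := by
  let f : A →ₗ[k] EInfty E x := Submodule.mkQ _ ∘ₗ
    g.codRestrict (permanentCycles E x) fun a => hg ▸ LinearMap.mem_range_self g a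
  have hf : Function.Surjective f := by
    refine (Submodule.mkQ_surjective _).comp fun ⟨e, he⟩ => ?_
    obtain ⟨a, rfl⟩ := hg.ge he
    exact ⟨a, rfl⟩
  refine ⟨linearEquivOfKerEq f h hf hh (Submodule.ext fun a => ?_)⟩
  exact (Submodule.Quotient.mk_eq_zero _).trans (hgh a)

/-- A grading of the positions of a spectral sequence: the differential of the `r`-th page moves
by `shift r`, which raises the filtration degree `fil` by `r` and the total degree `deg` by one. -/
structure PageGrading (κ : Type) [AddGroup κ] where
  shift : ℤ → κ
  fil : κ →+ ℤ
  deg : κ →+ ℤ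
  fil_shift : ∀ r, fil (shift r) = r
  deg_shift : ∀ r, deg (shift r) = 1

namespace PageGrading

variable {κ : Type} [AddGroup κ] {P : PageGrading κ} {r : ℤ} {x y : κ}

lemma fil_add (h : x + P.shift r = y) : P.fil x + r = P.fil y := by
  rw [← h, map_add, P.fil_shift]

lemma deg_add (h : x + P.shift r = y) : P.deg x + 1 = P.deg y := by
  rw [← h, map_add, P.deg_shift]

variable (P r x)

lemma add_shift_eq_next : x + P.shift r = (ComplexShape.up' (P.shift r)).next x :=
  ((ComplexShape.up' (P.shift r)).next_eq' rfl).symm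

lemma prev_add_shift : (ComplexShape.up' (P.shift r)).prev x + P.shift r = x := by
  rw [(ComplexShape.up' (P.shift r)).prev_eq' (sub_add_cancel x (P.shift r)), sub_add_cancel]

end PageGrading

/-! ### The pages of a filtered complex -/

/-- A cochain complex with a decreasing filtration by subcomplexes; `F p n` is the part of
filtration degree `p` in cohomological degree `n`. -/
structure FilteredComplex (R : Type u) [Ring R] where
  K : CochainComplex (ModuleCat.{v} R) ℤ
  F : ∀ _ n : ℤ, Submodule R (K.X n)
  F_succ_le : ∀ p n, F (p + 1) n ≤ F p n
  d_mem : ∀ p n m, ∀ a ∈ F p n, K.d n m a ∈ F p m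

namespace FilteredComplex

section Pages

variable {R : Type u} [Ring R] (Φ : FilteredComplex.{u, v} R)

variable {Φ} in
lemma F_anti {p q n : ℤ} {a : Φ.K.X n} (ha : a ∈ Φ.F p n) (h : q ≤ p) : a ∈ Φ.F q n :=
  antitone_int_of_succ_le (f := fun p => Φ.F p n) (fun p => Φ.F_succ_le p n) h ha

/-- `Z_r^p`: the elements of filtration degree `p` whose differential has filtration degree
`p + r`. -/
def Z (r p n : ℤ) : Submodule R (Φ.K.X n) :=
  Φ.F p n ⊓ (Φ.F (p + r) (n + 1)).comap (Φ.K.d n (n + 1)).hom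

/-- The elements that vanish on the `r`-th page: `F^{p+1} + d F^{p-r+1}`. They need not lie in
`Z r p n`. -/
def D (r p n : ℤ) : Submodule R (Φ.K.X n) :=
  Φ.F (p + 1) n ⊔ (Φ.F (p - r + 1) (n - 1)).map (Φ.K.d (n - 1) n).hom

variable {Φ}

lemma mem_Z {r p n n' : ℤ} (h : n + 1 = n') {a : Φ.K.X n} :
    a ∈ Φ.Z r p n ↔ a ∈ Φ.F p n ∧ Φ.K.d n n' a ∈ Φ.F (p + r) n' := by
  subst h
  rfl

lemma mem_D {r p n n' : ℤ} (h : n' + 1 = n) {a : Φ.K.X n} :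
    a ∈ Φ.D r p n ↔ ∃ w ∈ Φ.F (p - r + 1) n', a - Φ.K.d n' n w ∈ Φ.F (p + 1) n := by
  obtain rfl : n' = n - 1 := by lia
  simp only [D, Submodule.mem_sup, Submodule.mem_map]
  constructor
  · rintro ⟨y, hy, _, ⟨w, hw, rfl⟩, rfl⟩
    exact ⟨w, hw, by simpa using hy⟩
  · rintro ⟨w, hw, h⟩
    exact ⟨_, h, _, ⟨w, hw, rfl⟩, sub_add_cancel _ _⟩

lemma F_succ_le_D (r p n : ℤ) : Φ.F (p + 1) n ≤ Φ.D r p n := le_sup_left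

lemma Z_anti {r s : ℤ} (h : r ≤ s) (p n : ℤ) : Φ.Z s p n ≤ Φ.Z r p n :=
  fun _ ha => ⟨ha.1, F_anti ha.2 (by lia)⟩

lemma mem_Z_of_d_eq_zero (r : ℤ) {p n : ℤ} {a : Φ.K.X n} (ha : a ∈ Φ.F p n)
    (hd : Φ.K.d n (n + 1) a = 0) : a ∈ Φ.Z r p n :=
  (mem_Z rfl).2 ⟨ha, hd ▸ zero_mem _⟩

lemma d_mem_Z (s : ℤ) {r p n p' n' : ℤ} (hp : p + r = p') (hn : n + 1 = n') {a : Φ.K.X n}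
    (ha : a ∈ Φ.Z r p n) : Φ.K.d n n' a ∈ Φ.Z s p' n' :=
  mem_Z_of_d_eq_zero s (hp ▸ ((mem_Z hn).1 ha).2) (cochain_d_d Φ.K _ _ _ a)

variable (Φ) in
/-- The term `E_r` in filtration degree `p` and total degree `n`. -/
abbrev PageX (r p n : ℤ) : Type v := Φ.Z r p n ⧸ (Φ.D r p n).submoduleOf (Φ.Z r p n)

variable (Φ) in
/-- The class on the `r`-th page of an element of `Z r p n`. -/
def cls (r p n : ℤ) : Φ.Z r p n →ₗ[R] Φ.PageX r p n := Submodule.mkQ _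

lemma cls_surjective (r p n : ℤ) : Function.Surjective (Φ.cls r p n) :=
  Submodule.mkQ_surjective _

lemma cls_eq_zero {r p n : ℤ} {z : Φ.Z r p n} :
    Φ.cls r p n z = 0 ↔ (z : Φ.K.X n) ∈ Φ.D r p n :=
  Submodule.Quotient.mk_eq_zero _

lemma cls_eq_cls {r p n : ℤ} {z z' : Φ.Z r p n} :
    Φ.cls r p n z = Φ.cls r p n z' ↔ (z - z' : Φ.K.X n) ∈ Φ.D r p n :=
  Submodule.Quotient.eq _

variable (Φ) in
/-- The differential of the `r`-th page. -/
def pageD (r : ℤ) {p n p' n' : ℤ} (hp : p + r = p') (hn : n + 1 = n') :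
    Φ.PageX r p n →ₗ[R] Φ.PageX r p' n' :=
  Submodule.mapQ _ _ ((Φ.K.d n n').hom.restrict fun _ ha => d_mem_Z r hp hn ha) fun a ha => by
    obtain ⟨w, -, hw⟩ := (mem_D (sub_add_cancel n 1)).1 ha
    refine (mem_D hn).2 ⟨_, (show p' - r + 1 = p + 1 by lia) ▸ hw, ?_⟩
    simp [cochain_d_d]

lemma pageD_cls {r p n p' n' : ℤ} (hp : p + r = p') (hn : n + 1 = n') (z : Φ.Z r p n) :
    Φ.pageD r hp hn (Φ.cls r p n z) = Φ.cls r p' n' ⟨Φ.K.d n n' z, d_mem_Z r hp hn z.2⟩ :=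
  rfl

lemma pageD_pageD {r p n p' n' p'' n'' : ℤ} (hp : p + r = p') (hn : n + 1 = n')
    (hp' : p' + r = p'') (hn' : n' + 1 = n'') (x : Φ.PageX r p n) :
    Φ.pageD r hp' hn' (Φ.pageD r hp hn x) = 0 := by
  obtain ⟨z, rfl⟩ := cls_surjective r p n x
  simp only [pageD_cls, cochain_d_d, cls_eq_zero, zero_mem]

variable (Φ) in
/-- The map `Z_{r+1} → E_r`; it presents `E_{r+1}` as the homology of `E_r`. -/
def nextCycles (r p n : ℤ) : Φ.Z (r + 1) p n →ₗ[R] Φ.PageX r p n :=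
  Φ.cls r p n ∘ₗ Submodule.inclusion (Z_anti (by lia) p n)

lemma range_nextCycles {r p n p' n' : ℤ} (hp : p + r = p') (hn : n + 1 = n') :
    LinearMap.range (Φ.nextCycles r p n) = LinearMap.ker (Φ.pageD r hp hn) := by
  apply le_antisymm
  · rintro _ ⟨z, rfl⟩
    refine cls_eq_zero.2 (F_succ_le_D _ _ _ ?_)
    exact F_anti ((mem_Z hn).1 z.2).2 (by lia)
  · intro x hx
    obtain ⟨z, rfl⟩ := cls_surjective r p n x
    obtain ⟨w, hw, hzw⟩ := (mem_D hn).1 (cls_eq_zero.1 hx)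
    replace hw : w ∈ Φ.F (p + 1) n := F_anti hw (by lia)
    refine ⟨⟨z - w, (mem_Z hn).2 ⟨sub_mem z.2.1 (F_anti hw (by lia)), ?_⟩⟩, ?_⟩
    · rw [map_sub]
      exact F_anti hzw (by lia)
    · refine cls_eq_cls.2 (F_succ_le_D _ _ _ ?_)
      simpa using hw

lemma nextCycles_mem_range_iff {r p n p' n' : ℤ} (hp : p' + r = p) (hn : n' + 1 = n)
    (z : Φ.Z (r + 1) p n) :
    Φ.nextCycles r p n z ∈ LinearMap.range (Φ.pageD r hp hn) ↔ Φ.cls (r + 1) p n z = 0 := by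
  rw [cls_eq_zero, mem_D hn]
  constructor
  · rintro ⟨x, hx⟩
    obtain ⟨a, rfl⟩ := cls_surjective _ _ _ x
    obtain ⟨w, hw, h⟩ := (mem_D hn).1 (cls_eq_cls.1 hx.symm)
    refine ⟨w + a, add_mem (F_anti hw (by lia)) (F_anti a.2.1 (by lia)), ?_⟩
    rw [map_add, ← sub_sub, sub_right_comm]
    exact h
  · rintro ⟨w, hw, h⟩
    have hdw : Φ.K.d n' n w ∈ Φ.F p n := by
      simpa using sub_mem z.2.1 (Φ.F_succ_le p n h)
    have hwZ : w ∈ Φ.Z r p' n' := (mem_Z hn).2 ⟨F_anti hw (by lia), hp.symm ▸ hdw⟩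
    exact ⟨Φ.cls _ _ _ ⟨w, hwZ⟩, (cls_eq_cls.2 (F_succ_le_D _ _ _ h)).symm⟩

end Pages

section SpectralSequence

variable {R : Type u} [Ring R] (Φ : FilteredComplex.{u, v} R) {κ : Type} [AddGroup κ]
  (P : PageGrading κ)

/-- The `r`-th page of the spectral sequence of a filtered complex. -/
noncomputable def page (r : ℤ) :
    HomologicalComplex (ModuleCat.{v} R) (ComplexShape.up' (P.shift r)) where
  X x := ModuleCat.of R (Φ.PageX r (P.fil x) (P.deg x))
  d x y := open Classical in if h : x + P.shift r = y then
    ModuleCat.ofHom (Φ.pageD r (P.fil_add h) (P.deg_add h)) else 0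
  shape x y h := dif_neg h
  d_comp_d' x y z (h : x + P.shift r = y) (h' : y + P.shift r = z) := by
    rw [dif_pos h, dif_pos h']
    exact ModuleCat.hom_ext (LinearMap.ext fun a =>
      pageD_pageD (P.fil_add h) (P.deg_add h) (P.fil_add h') (P.deg_add h') a)

variable {P}

lemma page_d {r : ℤ} {x y : κ} (h : x + P.shift r = y) : (Φ.page P r).d x y =
    ModuleCat.ofHom (Φ.pageD r (P.fil_add h) (P.deg_add h)) :=
  dif_pos h

lemma page_d_cls {r : ℤ} {x y : κ} (h : x + P.shift r = y) (z : Φ.Z r (P.fil x) (P.deg x)) :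
    (Φ.page P r).d x y (Φ.cls r _ _ z) = Φ.cls r (P.fil y) (P.deg y)
      ⟨Φ.K.d _ _ z, d_mem_Z r (P.fil_add h) (P.deg_add h) z.2⟩ := by
  rw [page_d Φ h]
  rfl

variable (P)

lemma range_nextCycles_eq_ker_page_d (r : ℤ) (x : κ) :
    LinearMap.range (Φ.nextCycles r (P.fil x) (P.deg x)) =
      LinearMap.ker ((Φ.page P r).sc x).g.hom := by
  have h := P.add_shift_eq_next r x
  refine (range_nextCycles (P.fil_add h) (P.deg_add h)).trans ?_
  exact congr(LinearMap.ker (ModuleCat.Hom.hom $(Φ.page_d h))).symm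

lemma nextCycles_mem_range_page_d_iff (r : ℤ) (x : κ) (z : Φ.Z (r + 1) (P.fil x) (P.deg x)) :
    Φ.nextCycles r _ _ z ∈ LinearMap.range ((Φ.page P r).sc x).f.hom ↔
      Φ.cls (r + 1) _ _ z = 0 := by
  have h := P.prev_add_shift r x
  rw [← nextCycles_mem_range_iff (P.fil_add h) (P.deg_add h) z]
  exact iff_of_eq congr(_ ∈ LinearMap.range (ModuleCat.Hom.hom $(Φ.page_d h)))

/-- `E_{r+1}` is the homology of `E_r`. -/
noncomputable def pageIso (r : ℤ) (x : κ) :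
    (Φ.page P r).homology x ≅ (Φ.page P (r + 1)).X x :=
  homologyIsoOfPresentation ((Φ.page P r).sc x) (Φ.nextCycles r _ _) (Φ.cls (r + 1) _ _)
    (Φ.range_nextCycles_eq_ker_page_d P r x) (cls_surjective _ _ _)
    (Φ.nextCycles_mem_range_page_d_iff P r x)

lemma pageIso_hom_homologyπ {r : ℤ} {x : κ} {c : (Φ.page P r).cycles x}
    {z : Φ.Z (r + 1) (P.fil x) (P.deg x)}
    (h : (Φ.page P r).iCycles x c = Φ.nextCycles r _ _ z) :
    (Φ.pageIso P r x).hom ((Φ.page P r).homologyπ x c) = Φ.cls (r + 1) _ _ z :=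
  homologyIsoOfPresentation_hom_homologyπ _ _ _ _ h

/-- The spectral sequence of a filtered complex, starting at the page `r₀`. -/
noncomputable def spectralSequence (r₀ : ℤ) :
    SpectralSequence (ModuleCat.{v} R) (fun r => ComplexShape.up' (P.shift r)) r₀ where
  page r _ := Φ.page P r
  iso r _ x h _ := Φ.pageIso P r x ≪≫ eqToIso (by subst h; rfl)

end SpectralSequence

section Boundaries

variable {R : Type u} [Ring R] {Φ : FilteredComplex.{u, v} R}

variable (Φ) in
/-- `B_r^p`: the elements of filtration degree `p` that are the differential of an element of
filtration degree `p - r + 1`. -/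
def B (r p n : ℤ) : Submodule R (Φ.K.X n) :=
  Φ.F p n ⊓ (Φ.F (p - r + 1) (n - 1)).map (Φ.K.d (n - 1) n).hom

lemma B_le_Z (r s p n : ℤ) : Φ.B r p n ≤ Φ.Z s p n := by
  rintro _ ⟨h, w, -, rfl⟩
  exact mem_Z_of_d_eq_zero s h (cochain_d_d Φ.K _ _ _ w)

lemma B_le_D (r p n : ℤ) : Φ.B r p n ≤ Φ.D r p n := inf_le_right.trans le_sup_right

lemma B_mono (p n : ℤ) : Monotone fun r => Φ.B r p n := by
  rintro r s hrs _ ⟨h, w, hw, rfl⟩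
  exact ⟨h, w, F_anti hw (by lia), rfl⟩

variable (Φ) in
/-- The subspace of the `r`-th page that consists of the classes of elements of `S`. -/
def classes (r p n : ℤ) (S : Submodule R (Φ.K.X n)) : Submodule R (Φ.PageX r p n) :=
  (S.comap (Φ.Z r p n).subtype).map (Φ.cls r p n)

lemma cls_mem_classes {r p n : ℤ} {S : Submodule R (Φ.K.X n)} (hS : S ≤ Φ.Z r p n)
    {z : Φ.Z r p n} : Φ.cls r p n z ∈ Φ.classes r p n S ↔ ∃ s ∈ S, (z - s : Φ.K.X n) ∈ Φ.D r p n :=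
  ⟨fun ⟨s, hs, h⟩ => ⟨s, hs, cls_eq_cls.1 h.symm⟩,
    fun ⟨s, hs, h⟩ => ⟨⟨s, hS hs⟩, hs, (cls_eq_cls.2 h).symm⟩⟩

end Boundaries

section Cohomology

variable {R : Type u} [Ring R] {Φ : FilteredComplex.{u, v} R}

variable (Φ) in
/-- The filtration of the cohomology by the classes of cocycles of filtration degree `p`. -/
noncomputable def cohomologyFiltration (p n : ℤ) : Submodule R (Φ.K.homology n) :=
  ((Φ.F p n).comap (Φ.K.iCycles n).hom).map (Φ.K.homologyπ n).hom

lemma homologyπ_mem_cohomologyFiltration_iff {p n : ℤ} {c : Φ.K.cycles n} :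
    Φ.K.homologyπ n c ∈ Φ.cohomologyFiltration p n ↔
      ∃ w, Φ.K.iCycles n c - Φ.K.d (n - 1) n w ∈ Φ.F p n := by
  constructor
  · rintro ⟨c', hc', h⟩
    obtain ⟨w, hw⟩ := (cochain_homologyπ_eq_zero_iff (c - c')).1 (by
      rw [map_sub, sub_eq_zero]
      exact h.symm)
    refine ⟨w, ?_⟩
    rwa [hw, map_sub, sub_sub_cancel]
  · rintro ⟨w, hw⟩
    obtain ⟨c', hc'⟩ := exists_cochain_iCycles_eq (a := Φ.K.iCycles n c - Φ.K.d (n - 1) n w) (by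
      rw [map_sub, cochain_d_iCycles, cochain_d_d, sub_zero])
    refine ⟨c', congr($hc' ∈ Φ.F p n).mpr hw, (sub_eq_zero.1 ?_).symm⟩
    rw [← map_sub]
    exact (cochain_homologyπ_eq_zero_iff _).2 ⟨w, by rw [map_sub, hc', sub_sub_cancel]⟩

variable (Φ) in
/-- The cocycles of filtration degree `p`. They present both the limit page and the associated
graded space of the cohomology. -/
noncomputable abbrev filteredCycles (p n : ℤ) : Submodule R (Φ.K.cycles n) :=
  (Φ.F p n).comap (Φ.K.iCycles n).hom

variable (Φ) in
/-- The map from `filteredCycles` to the page `E_r`. -/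
noncomputable def toPage (r p n : ℤ) : Φ.filteredCycles p n →ₗ[R] Φ.PageX r p n :=
  Φ.cls r p n ∘ₗ ((Φ.K.iCycles n).hom ∘ₗ Submodule.subtype _).codRestrict _
    fun c => mem_Z_of_d_eq_zero r c.2 (cochain_d_iCycles c.1)

lemma range_toPage (r p n : ℤ) : LinearMap.range (Φ.toPage r p n) =
    Φ.classes r p n (Φ.F p n ⊓ LinearMap.ker (Φ.K.d n (n + 1)).hom) := by
  apply le_antisymm
  · rintro _ ⟨c, rfl⟩
    exact ⟨_, ⟨c.2, cochain_d_iCycles c.1⟩, rfl⟩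
  · rintro _ ⟨⟨z, hz⟩, ⟨hF, hd⟩, rfl⟩
    obtain ⟨c, rfl⟩ := exists_cochain_iCycles_eq hd
    exact ⟨⟨c, hF⟩, rfl⟩

end Cohomology

section Differentials

variable {R : Type u} [Ring R] {Φ : FilteredComplex.{u, v} R} {κ : Type} [AddGroup κ]
  {P : PageGrading κ} {r₀ : ℤ}

lemma spectralSequence_iso_hom_homologyπ {r : ℤ} (hr : r₀ ≤ r) {x : κ}
    {c : (Φ.page P r).cycles x} {z : Φ.Z (r + 1) (P.fil x) (P.deg x)}
    (h : (Φ.page P r).iCycles x c = Φ.nextCycles r _ _ z) :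
    ((Φ.page P r).homologyπ x ≫ ((Φ.spectralSequence P r₀).iso r (r + 1) x rfl hr).hom).hom c =
      Φ.cls (r + 1) _ _ z := by
  rw [← Φ.pageIso_hom_homologyπ P h]
  simp only [spectralSequence, eqToIso_refl, Iso.trans_refl]
  rfl

lemma page_d_eq_zero {x y : κ} {p r : ℤ} (hp : Φ.F p (P.deg x + 1) = ⊥)
    (hr : p - P.fil x ≤ r) : (Φ.page P r).d x y = 0 := by
  by_cases h : x + P.shift r = y
  · refine ModuleCat.hom_ext (LinearMap.ext fun e => ?_)
    obtain ⟨z, rfl⟩ := cls_surjective _ _ _ e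
    have hdz : Φ.K.d (P.deg x) (P.deg y) z ∈ Φ.F p (P.deg y) :=
      F_anti ((mem_Z (P.deg_add h)).1 z.2).2 (show p ≤ P.fil x + r by lia)
    rw [P.deg_add h] at hp
    rw [hp, Submodule.mem_bot] at hdz
    refine (Φ.page_d_cls h z).trans (cls_eq_zero.2 ?_)
    exact congr($hdz ∈ Φ.D r (P.fil y) (P.deg y)).mpr (zero_mem _)
  · exact (Φ.page P r).shape x y h

end Differentials

section Limit

variable {k : Type u} [Field k] {Φ : FilteredComplex.{u, v} k} {κ : Type} [AddGroup κ]
  {P : PageGrading κ} {r₀ : ℤ}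

lemma pullback_eq (r : ℤ) (hr : r₀ ≤ r) (x : κ)
    (S : Submodule k (Φ.PageX (r + 1) (P.fil x) (P.deg x))) :
    SpecSeq.pullback (Φ.spectralSequence P r₀) x r hr S =
      (S.comap (Φ.cls (r + 1) _ _)).map (Φ.nextCycles r _ _) := by
  have range_eq : LinearMap.range ((Φ.page P r).iCycles x).hom =
      LinearMap.range (Φ.nextCycles r (P.fil x) (P.deg x)) :=
    (moduleCat_range_iCycles ((Φ.page P r).sc x)).trans
      (Φ.range_nextCycles_eq_ker_page_d P r x).symm
  apply le_antisymm
  · rintro _ ⟨c, hc, rfl⟩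
    obtain ⟨z, hz⟩ := range_eq.le ⟨c, rfl⟩
    exact ⟨z, congr($(spectralSequence_iso_hom_homologyπ hr hz.symm) ∈ S).mp hc, hz⟩
  · rintro _ ⟨z, hz, rfl⟩
    obtain ⟨c, hc⟩ := range_eq.ge ⟨z, rfl⟩
    exact ⟨c, congr($(spectralSequence_iso_hom_homologyπ hr hc) ∈ S).mpr hz, hc⟩

lemma pullback_classes (r : ℤ) (hr : r₀ ≤ r) (x : κ) {S : Submodule k (Φ.K.X (P.deg x))}
    (hB : Φ.B (r + 1) (P.fil x) (P.deg x) ≤ S) (hZ : S ≤ Φ.Z (r + 1) (P.fil x) (P.deg x)) :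
    SpecSeq.pullback (Φ.spectralSequence P r₀) x r hr (Φ.classes (r + 1) _ _ S) =
      Φ.classes r _ _ S := by
  rw [pullback_eq]
  apply le_antisymm
  · rintro _ ⟨z, hz, rfl⟩
    obtain ⟨s, hs, h⟩ := (cls_mem_classes hZ).1 hz
    obtain ⟨w, hw, hzsw⟩ := (mem_D (sub_add_cancel _ 1)).1 h
    have hdw : Φ.K.d _ _ w ∈ Φ.F (P.fil x) (P.deg x) := by
      simpa using sub_mem (sub_mem z.2.1 (hZ hs).1) (Φ.F_succ_le _ _ hzsw)
    refine (cls_mem_classes (hZ.trans (Z_anti (by lia) _ _))).2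
      ⟨s + Φ.K.d _ _ w, add_mem hs (hB ⟨hdw, w, hw, rfl⟩), F_succ_le_D _ _ _ ?_⟩
    rwa [← sub_sub]
  · rintro _ ⟨s, hs, rfl⟩
    exact ⟨⟨s, hZ hs⟩, ⟨⟨s, hZ hs⟩, hs, rfl⟩, rfl⟩

lemma surviving_eq (x : κ) (n : ℕ) (r : ℤ) (hr : r₀ ≤ r) :
    SpecSeq.surviving (Φ.spectralSequence P r₀) x n r hr =
      Φ.classes r _ _ (Φ.Z (r + n) (P.fil x) (P.deg x)) := by
  induction n generalizing r with
  | zero =>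
    refine (eq_top_iff.2 fun e _ => ?_).symm
    obtain ⟨z, rfl⟩ := cls_surjective _ _ _ e
    exact ⟨z, by simp, rfl⟩
  | succ n ih =>
    have hr' : r + 1 + n = r + (n + 1 : ℕ) := by push_cast; ring
    rw [SpecSeq.surviving, ih, pullback_classes r hr x (B_le_Z _ _ _ _) (Z_anti (by lia) _ _), hr']

lemma dying_eq (x : κ) (n : ℕ) (r : ℤ) (hr : r₀ ≤ r) :
    SpecSeq.dying (Φ.spectralSequence P r₀) x n r hr =
      Φ.classes r _ _ (Φ.B (r + n) (P.fil x) (P.deg x)) := by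
  induction n generalizing r with
  | zero =>
    refine (eq_bot_iff.2 ?_).symm
    rintro _ ⟨z, hz, rfl⟩
    refine cls_eq_zero.2 (B_le_D _ _ _ ?_)
    simpa using hz
  | succ n ih =>
    have hr' : r + 1 + n = r + (n + 1 : ℕ) := by push_cast; ring
    rw [SpecSeq.dying, ih, pullback_classes r hr x (B_mono _ _ (by lia)) (B_le_Z _ _ _ _), hr']

lemma permanentCycles_eq (x : κ) {p : ℤ} (hp : Φ.F p (P.deg x + 1) = ⊥) :
    SpecSeq.permanentCycles (Φ.spectralSequence P r₀) x = Φ.classes r₀ _ _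
      (Φ.F (P.fil x) (P.deg x) ⊓ LinearMap.ker (Φ.K.d (P.deg x) (P.deg x + 1)).hom) := by
  simp only [SpecSeq.permanentCycles, surviving_eq]
  apply le_antisymm
  · refine (iInf_le _ (p - P.fil x - r₀).toNat).trans
      (Submodule.map_mono (Submodule.comap_mono fun z hz => ⟨hz.1, ?_⟩))
    have hdz : Φ.K.d _ _ z ∈ Φ.F p (P.deg x + 1) := F_anti hz.2 (by lia)
    rwa [hp] at hdz
  · exact le_iInf fun n => Submodule.map_mono
      (Submodule.comap_mono fun z hz => mem_Z_of_d_eq_zero _ hz.1 hz.2)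

lemma cls_mem_eventualBoundaries_iff (hex : ∀ n a, ∃ p, a ∈ Φ.F p n) {x : κ}
    {z : Φ.Z r₀ (P.fil x) (P.deg x)} :
    Φ.cls r₀ _ _ z ∈ SpecSeq.eventualBoundaries (Φ.spectralSequence P r₀) x ↔
      ∃ w, z - Φ.K.d (P.deg x - 1) (P.deg x) w ∈ Φ.F (P.fil x + 1) (P.deg x) := by
  simp only [SpecSeq.eventualBoundaries, dying_eq]
  refine (Submodule.mem_iSup_of_directed _ (Monotone.directed_le fun m n h =>
    Submodule.map_mono (Submodule.comap_mono (B_mono _ _ (by lia))))).trans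
    ((exists_congr fun n => cls_mem_classes (B_le_Z _ _ _ _)).trans ?_)
  constructor
  · rintro ⟨n, _, ⟨-, w', -, rfl⟩, h⟩
    obtain ⟨w, -, hw⟩ := (mem_D (sub_add_cancel _ 1)).1 h
    exact ⟨w' + w, by rwa [map_add, ← sub_sub]⟩
  · rintro ⟨w, hw⟩
    obtain ⟨q, hq⟩ := hex _ w
    have hdw : Φ.K.d _ _ w ∈ Φ.F (P.fil x) (P.deg x) := by
      simpa using sub_mem z.2.1 (Φ.F_succ_le _ _ hw)
    exact ⟨(P.fil x - r₀ + 1 - q).toNat, _, ⟨hdw, w, F_anti hq (by lia), rfl⟩,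
      F_succ_le_D _ _ _ hw⟩

end Limit

section Convergence

variable {k : Type u} [Field k] {Φ : FilteredComplex.{u, v} k} {κ : Type} [AddGroup κ]
  {P : PageGrading κ} {r₀ : ℤ}

variable (Φ) in
/-- The map from `filteredCycles` to the associated graded space of the cohomology. -/
noncomputable def toGr (p n : ℤ) : Φ.filteredCycles p n →ₗ[k]
    SpecSeq.gr (H := fun n => Φ.K.homology n) Φ.cohomologyFiltration p n :=
  Submodule.mkQ _ ∘ₗ (Φ.K.homologyπ n).hom.submoduleMap (Φ.filteredCycles p n)

lemma toGr_surjective (p n : ℤ) : Function.Surjective (Φ.toGr p n) :=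
  (Submodule.mkQ_surjective _).comp (LinearMap.submoduleMap_surjective _ _)

lemma toGr_eq_zero_iff {p n : ℤ} (c : Φ.filteredCycles p n) : Φ.toGr p n c = 0 ↔
    ∃ w, Φ.K.iCycles n c.1 - Φ.K.d (n - 1) n w ∈ Φ.F (p + 1) n :=
  (Submodule.Quotient.mk_eq_zero _).trans homologyπ_mem_cohomologyFiltration_iff

lemma nonempty_eInfty_equiv_gr (hex : ∀ n a, ∃ p, a ∈ Φ.F p n) (hterm : ∀ n, ∃ p, Φ.F p n = ⊥)
    (x : κ) : Nonempty (SpecSeq.EInfty (Φ.spectralSequence P r₀) x ≃ₗ[k]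
      SpecSeq.gr (H := fun n => Φ.K.homology n) Φ.cohomologyFiltration (P.fil x) (P.deg x)) := by
  obtain ⟨p, hp⟩ := hterm (P.deg x + 1)
  exact SpecSeq.nonempty_eInfty_equiv _ x (Φ.toPage r₀ _ _)
    ((range_toPage _ _ _).trans (permanentCycles_eq x hp).symm) (toGr_surjective _ _) fun c =>
      (cls_mem_eventualBoundaries_iff hex).trans (toGr_eq_zero_iff c).symm

theorem spectralSequence_convergesTo (hex : ∀ n a, ∃ p, a ∈ Φ.F p n)
    (hterm : ∀ n, ∃ p, Φ.F p n = ⊥) :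
    SpecSeq.ConvergesTo (Φ.spectralSequence P r₀) P.fil P.deg (fun n => Φ.K.homology n)
      Φ.cohomologyFiltration where
  regular x := by
    obtain ⟨p, hp⟩ := hterm (P.deg x + 1)
    exact ⟨p - P.fil x, fun r _ hr y => page_d_eq_zero hp hr⟩
  decreasing p n := Submodule.map_mono (Submodule.comap_mono (Φ.F_succ_le p n))
  exhaustive n := by
    refine eq_top_iff.2 fun y _ => ?_
    obtain ⟨c, rfl⟩ := moduleCat_homologyπ_surjective (Φ.K.sc n) y
    obtain ⟨p, hp⟩ := hex n (Φ.K.iCycles n c)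
    exact Submodule.mem_iSup_of_mem p ⟨c, hp, rfl⟩
  terminates n := by
    obtain ⟨p, hp⟩ := hterm n
    refine ⟨p, ?_⟩
    have ker_iCycles : LinearMap.ker (Φ.K.iCycles n).hom = ⊥ :=
      LinearMap.ker_eq_bot.2 (moduleCat_iCycles_injective (Φ.K.sc n))
    rw [cohomologyFiltration, hp, Submodule.comap_bot, ker_iCycles, Submodule.map_bot]
  limit x := nonempty_eInfty_equiv_gr hex hterm x

end Convergence

section FirstPage

variable {R : Type u} [Ring R] {Φ : FilteredComplex.{u, v} R}

/-- The map `ι` into `F^p` induces an isomorphism with `F^p / F^{p+1}`. -/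
structure IsGrEquiv {N : ModuleCat.{v} R} {n : ℤ} (p : ℤ) (ι : N →ₗ[R] Φ.K.X n) : Prop where
  mem : ∀ m, ι m ∈ Φ.F p n
  exists_sub_mem : ∀ a ∈ Φ.F p n, ∃ m, a - ι m ∈ Φ.F (p + 1) n
  eq_zero : ∀ m, ι m ∈ Φ.F (p + 1) n → m = 0

variable (Φ) in
/-- An identification of `S` with the associated graded complex `F^p / F^{p+1}` around the
cohomological degree `n`. -/
structure GradedChart (S : ShortComplex (ModuleCat.{v} R)) (p n : ℤ) where
  ι₁ : S.X₁ →ₗ[R] Φ.K.X (n - 1)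
  ι₂ : S.X₂ →ₗ[R] Φ.K.X n
  ι₃ : S.X₃ →ₗ[R] Φ.K.X (n + 1)
  isGrEquiv₁ : IsGrEquiv p ι₁
  isGrEquiv₂ : IsGrEquiv p ι₂
  isGrEquiv₃ : IsGrEquiv p ι₃
  d_ι₁_sub_mem : ∀ m, Φ.K.d (n - 1) n (ι₁ m) - ι₂ (S.f m) ∈ Φ.F (p + 1) n
  d_ι₂_sub_mem : ∀ m, Φ.K.d n (n + 1) (ι₂ m) - ι₃ (S.g m) ∈ Φ.F (p + 1) (n + 1)

namespace GradedChart

variable {S S' : ShortComplex (ModuleCat.{v} R)} {p n : ℤ} (χ : Φ.GradedChart S p n)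

lemma ι₂_mem_Z {m : S.X₂} (hm : S.g m = 0) : χ.ι₂ m ∈ Φ.Z 1 p n :=
  ⟨χ.isGrEquiv₂.mem m, by simpa [hm] using χ.d_ι₂_sub_mem m⟩

/-- The map from the cycles of `S` to the first page. -/
def toPage : LinearMap.ker S.g.hom →ₗ[R] Φ.PageX 1 p n :=
  Φ.cls 1 p n ∘ₗ (χ.ι₂ ∘ₗ Submodule.subtype _).codRestrict _ fun m => χ.ι₂_mem_Z m.2

lemma toPage_surjective : Function.Surjective χ.toPage := by
  intro x
  obtain ⟨z, rfl⟩ := cls_surjective _ _ _ x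
  obtain ⟨m, hm⟩ := χ.isGrEquiv₂.exists_sub_mem z z.2.1
  have g_m : S.g m = 0 := by
    refine χ.isGrEquiv₃.eq_zero _ ?_
    have := sub_mem (sub_mem ((mem_Z rfl).1 z.2).2 (Φ.d_mem _ _ (n + 1) _ hm))
      (χ.d_ι₂_sub_mem m)
    simpa using this
  refine ⟨⟨m, g_m⟩, cls_eq_cls.2 (F_succ_le_D _ _ _ ?_)⟩
  rw [← neg_mem_iff, neg_sub]
  exact hm

lemma toPage_eq_zero_iff (m : LinearMap.ker S.g.hom) :
    χ.toPage m = 0 ↔ (m : S.X₂) ∈ LinearMap.range S.f.hom := by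
  refine cls_eq_zero.trans ((mem_D (sub_add_cancel n 1)).trans ?_)
  rw [sub_add_cancel]
  change (∃ w ∈ Φ.F p (n - 1), χ.ι₂ m - Φ.K.d (n - 1) n w ∈ Φ.F (p + 1) n) ↔ _
  constructor
  · rintro ⟨w, hw, h⟩
    obtain ⟨l, hl⟩ := χ.isGrEquiv₁.exists_sub_mem w hw
    refine ⟨l, (sub_eq_zero.1 (χ.isGrEquiv₂.eq_zero _ ?_)).symm⟩
    have := add_mem (add_mem h (Φ.d_mem _ _ n _ hl)) (χ.d_ι₁_sub_mem l)
    simpa using this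
  · rintro ⟨l, hl⟩
    refine ⟨χ.ι₁ l, χ.isGrEquiv₁.mem l, ?_⟩
    rw [← hl, ← neg_mem_iff, neg_sub]
    exact χ.d_ι₁_sub_mem l

/-- The first page is the homology of the associated graded complex. -/
noncomputable def homologyIso : S.homology ≅ ModuleCat.of R (Φ.PageX 1 p n) :=
  homologyIsoOfPresentation (N := ModuleCat.of R (Φ.PageX 1 p n)) S
    (LinearMap.ker S.g.hom).subtype χ.toPage (Submodule.range_subtype _) χ.toPage_surjective
    fun m => (χ.toPage_eq_zero_iff m).symm

lemma homologyIso_hom_homologyπ (c : S.cycles) :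
    χ.homologyIso.hom (S.homologyπ c) = χ.toPage ⟨S.iCycles c, congr($(S.iCycles_g) c)⟩ :=
  homologyIsoOfPresentation_hom_homologyπ S _ _ _ rfl

variable {κ : Type} [AddGroup κ] {P : PageGrading κ} {x y : κ}

/-- `homologyIso` for a position of the spectral sequence. -/
noncomputable def pageIso (χ : Φ.GradedChart S (P.fil x) (P.deg x)) :
    (Φ.page P 1).X x ≅ S.homology :=
  χ.homologyIso.symm

lemma page_d_comp_pageIso_hom (h : x + P.shift 1 = y) (χ : Φ.GradedChart S (P.fil x) (P.deg x))
    (χ' : Φ.GradedChart S' (P.fil y) (P.deg y)) (φ : S ⟶ S')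
    (hφ : ∀ m, S.g m = 0 →
      Φ.K.d _ _ (χ.ι₂ m) - χ'.ι₂ (φ.τ₂ m) ∈ Φ.F (P.fil y + 1) (P.deg y)) :
    (Φ.page P 1).d x y ≫ χ'.pageIso.hom = χ.pageIso.hom ≫ ShortComplex.homologyMap φ := by
  rw [← Iso.inv_comp_eq, ← Category.assoc, ← Iso.eq_comp_inv, ← cancel_epi S.homologyπ,
    ShortComplex.homologyπ_naturality_assoc]
  refine ModuleCat.hom_ext (LinearMap.ext fun c => ?_)
  change (Φ.page P 1).d x y (χ.homologyIso.hom (S.homologyπ c)) =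
    χ'.homologyIso.hom (S'.homologyπ (ShortComplex.cyclesMap φ c))
  have iCycles_map : S'.iCycles (ShortComplex.cyclesMap φ c) = φ.τ₂ (S.iCycles c) :=
    congr($(ShortComplex.cyclesMap_i φ) c)
  rw [homologyIso_hom_homologyπ, homologyIso_hom_homologyπ]
  refine (Φ.page_d_cls h _).trans (cls_eq_cls.2 (F_succ_le_D _ _ _ ?_))
  have := hφ (S.iCycles c) congr($(S.iCycles_g) c)
  rwa [← iCycles_map] at this

end GradedChart

end FirstPage

end FilteredComplex

/-! ### The weight filtrations of a total complex -/

namespace Bicomplex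

variable {k : Type u} [Field k] {M : Bicomplex.{u, v} k}

section TotalComplex

variable {S : Set (ℤ × ℤ)} {i j n : ℤ}

variable (M) in
/-- The inclusion `ιTot`, as a map into the complex `M.total`. -/
def ιTotal (i j n : ℤ) (h : i + j = n) : M.X i j →ₗ[k] M.total.X n := M.ιTot i j n h

lemma ιTotal_apply_self (h : i + j = n) (m : M.X i j) :
    (show M.Tot n from M.ιTotal i j n h m) ⟨(i, j), h⟩ = m :=
  DFinsupp.single_eq_same

lemma ιTotal_apply_of_ne (h : i + j = n) (m : M.X i j)
    {x : {x : ℤ × ℤ // x.1 + x.2 = n}} (hx : x.1 ≠ (i, j)) :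
    (show M.Tot n from M.ιTotal i j n h m) x = 0 :=
  DFinsupp.single_eq_of_ne fun e => hx congr(($e).1)

lemma ιTotal_mem_supportedIn (h : i + j = n) (hS : (i, j) ∈ S) (m : M.X i j) :
    M.ιTotal i j n h m ∈ M.supportedIn S n :=
  fun _ hx => ιTotal_apply_of_ne h m fun e => hx (e ▸ hS)

lemma supportedIn_le {N : Submodule k (M.total.X n)}
    (hN : ∀ i j (h : i + j = n), (i, j) ∈ S → ∀ m, M.ιTotal i j n h m ∈ N) :
    M.supportedIn S n ≤ N := by
  classical
  intro t ht
  rw [← DirectSum.sum_support_of (show M.Tot n from t)]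
  refine sum_mem fun x hx => hN x.1.1 x.1.2 x.2 ?_ _
  by_contra hS
  exact DFinsupp.mem_support_iff.1 hx (ht x hS)

lemma total_d_ιTotal {i' j' n' : ℤ} (hi : i + 1 = i') (hj : j + 1 = j') (hn : i + j = n)
    (hn' : n + 1 = n') (m : M.X i j) : M.total.d n n' (M.ιTotal i j n hn m) =
      M.ιTotal i' j n' (by lia) (M.d₁ i i' j hi m) +
        M.ιTotal i j' n' (by lia) (M.d₂ i j j' hj m) := by
  subst hi hj
  simp only [total, dif_pos hn']
  exact M.totD_ιTot i j n n' hn hn' m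

lemma total_d_ιTotal_sub_d₁_mem {i' j' n' : ℤ} (hi : i + 1 = i') (hj : j + 1 = j')
    (hn : i + j = n) (hn' : n + 1 = n') (hS : (i, j') ∈ S) (m : M.X i j) :
    M.total.d n n' (M.ιTotal i j n hn m) - M.ιTotal i' j n' (by lia) (M.d₁ i i' j hi m) ∈
      M.supportedIn S n' := by
  rw [total_d_ιTotal hi hj hn hn', add_sub_cancel_left]
  exact ιTotal_mem_supportedIn _ hS _

lemma total_d_ιTotal_sub_d₂_mem {i' j' n' : ℤ} (hi : i + 1 = i') (hj : j + 1 = j')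
    (hn : i + j = n) (hn' : n + 1 = n') (hS : (i', j) ∈ S) (m : M.X i j) :
    M.total.d n n' (M.ιTotal i j n hn m) - M.ιTotal i j' n' (by lia) (M.d₂ i j j' hj m) ∈
      M.supportedIn S n' := by
  rw [total_d_ιTotal hi hj hn hn', add_sub_cancel_right]
  exact ιTotal_mem_supportedIn _ hS _

end TotalComplex

section Weight

variable {w : ℤ × ℤ →o ℤ}

variable (M w) in
/-- The total complex with the filtration by weight. Both differentials of `M` raise the position,
so they do not decrease a monotone weight. -/
def filteredTotal : FilteredComplex.{u, v} k where
  K := M.total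
  F p n := M.supportedIn {x | p ≤ w x} n
  F_succ_le p n t ht x hx := ht x fun h => hx (by simp only [Set.mem_ofPred_eq] at h ⊢; lia)
  d_mem p n n' t ht := by
    by_cases hn' : n + 1 = n'
    · refine supportedIn_le (N := (M.supportedIn {x | p ≤ w x} n').comap (M.total.d n n').hom)
        (fun i j h hw m => ?_) ht
      change M.total.d n n' _ ∈ M.supportedIn _ n'
      rw [total_d_ιTotal rfl rfl h hn']
      have column_le : (i, j) ≤ (i + 1, j) := Prod.mk_le_mk.2 ⟨by lia, le_rfl⟩
      have row_le : (i, j) ≤ (i, j + 1) := Prod.mk_le_mk.2 ⟨le_rfl, by lia⟩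
      exact add_mem (ιTotal_mem_supportedIn _ (show p ≤ _ from hw.trans (w.monotone column_le)) _)
        (ιTotal_mem_supportedIn _ (show p ≤ _ from hw.trans (w.monotone row_le)) _)
    · rw [M.total.shape n n' hn']
      exact zero_mem _

lemma exists_mem_filteredTotal_F (n : ℤ) (t : M.total.X n) :
    ∃ p, t ∈ (M.filteredTotal w).F p n := by
  classical
  obtain ⟨p, hp⟩ := ((DFinsupp.support (show M.Tot n from t)).image fun x => w x.1).bddBelow
  refine ⟨p, fun x hx => ?_⟩
  by_contra h
  exact hx (hp (Finset.mem_coe.2 (Finset.mem_image_of_mem _ (DFinsupp.mem_support_iff.2 h))))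

lemma filteredTotal_F_eq_bot {p n : ℤ}
    (h : ∀ i j, i + j = n → p ≤ w (i, j) → Subsingleton (M.X i j)) :
    (M.filteredTotal w).F p n = ⊥ := by
  refine eq_bot_iff.2 (supportedIn_le fun i j hn hp m => ?_)
  have := h i j hn hp
  rw [Subsingleton.elim m 0, map_zero]
  exact zero_mem _

lemma isGrEquiv_ιTotal {p i j n : ℤ} (h : i + j = n)
    (hw : ∀ x : ℤ × ℤ, x.1 + x.2 = n → (w x = p ↔ x = (i, j))) :
    (M.filteredTotal w).IsGrEquiv p (M.ιTotal i j n h) where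
  mem m := ιTotal_mem_supportedIn h ((hw (i, j) h).2 rfl).ge m
  exists_sub_mem a ha := by
    refine ⟨(show M.Tot n from a) ⟨(i, j), h⟩, fun x hx => ?_⟩
    change (show M.Tot n from a) x - (show M.Tot n from M.ιTotal i j n h _) x = 0
    by_cases hij : x.1 = (i, j)
    · obtain rfl : x = ⟨(i, j), h⟩ := Subtype.ext hij
      rw [ιTotal_apply_self, sub_self]
    · have hwx : w x.1 ≠ p := fun e => hij ((hw x.1 x.2).1 e)
      simp only [Set.mem_ofPred_eq] at hx
      rw [ha x (show ¬ p ≤ w x.1 by lia), ιTotal_apply_of_ne h _ hij, sub_zero]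
  eq_zero m hm := by
    rw [← ιTotal_apply_self h m]
    exact hm _ (show ¬ p + 1 ≤ w (i, j) by rw [(hw (i, j) h).2 rfl]; lia)

end Weight

variable (M)

section Column

/-- The column of a position is its filtration degree. -/
def columnGrading : PageGrading (ℤ × ℤ) where
  shift r := (r, 1 - r)
  fil := AddMonoidHom.fst ℤ ℤ
  deg := AddMonoidHom.fst ℤ ℤ + AddMonoidHom.snd ℤ ℤ
  fil_shift _ := rfl
  deg_shift r := by simp

/-- The total complex with the filtration by columns. -/
noncomputable abbrev columnFiltered : FilteredComplex.{u, v} k := M.filteredTotal OrderHom.fst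

lemma isGrEquiv_column (i j n : ℤ) (h : i + j = n) :
    M.columnFiltered.IsGrEquiv i (M.ιTotal i j n h) :=
  isGrEquiv_ιTotal h fun x hx => by
    rw [Prod.ext_iff]
    exact ⟨fun (hi : x.1 = i) => ⟨hi, by lia⟩, And.left⟩

/-- The associated graded complex of the column filtration is the column `(M^{i,•}, ∂₂)`. -/
noncomputable def columnChart (i j : ℤ) : M.columnFiltered.GradedChart (M.sc₂ i j) i (i + j) where
  ι₁ := M.ιTotal i (j - 1) (i + j - 1) (by lia)
  ι₂ := M.ιTotal i j (i + j) rfl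
  ι₃ := M.ιTotal i (j + 1) (i + j + 1) (by lia)
  isGrEquiv₁ := M.isGrEquiv_column _ _ _ _
  isGrEquiv₂ := M.isGrEquiv_column _ _ _ _
  isGrEquiv₃ := M.isGrEquiv_column _ _ _ _
  d_ι₁_sub_mem :=
    total_d_ιTotal_sub_d₂_mem rfl (sub_add_cancel j 1) _ (sub_add_cancel _ 1) (le_refl (i + 1))
  d_ι₂_sub_mem := total_d_ιTotal_sub_d₂_mem rfl rfl _ rfl (le_refl (i + 1))

/-- `E_1^{i,j} ≅ H^{i,j}(M, ∂₂)`. -/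
noncomputable def columnPageIso (i j : ℤ) :
    (M.columnFiltered.page columnGrading 1).X (i, j) ≅ M.H₂ i j :=
  FilteredComplex.GradedChart.pageIso (P := columnGrading) (x := (i, j)) (M.columnChart i j)

lemma page_d_comp_columnPageIso_hom (i j : ℤ) :
    (M.columnFiltered.page columnGrading 1).d (i, j) (i + 1, j) ≫
      (M.columnPageIso (i + 1) j).hom = (M.columnPageIso i j).hom ≫ M.inducedD₁ i j := by
  have h : (i, j) + columnGrading.shift 1 = (i + 1, j) := Prod.ext rfl (add_zero j)
  refine FilteredComplex.GradedChart.page_d_comp_pageIso_hom h (M.columnChart i j)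
    (M.columnChart (i + 1) j) (M.sc₂Map i j) fun (m : M.X i j)
      (hm : M.d₂ i j (j + 1) rfl m = 0) => ?_
  have d_ι : M.total.d _ _ (M.ιTotal i j (i + j) rfl m) =
      M.ιTotal (i + 1) j (i + 1 + j) rfl (M.d₁ i (i + 1) j rfl m) := by
    rw [total_d_ιTotal rfl rfl _ (by lia), hm, map_zero, add_zero]
  exact congr($(sub_eq_zero.2 d_ι) ∈ _).mpr (zero_mem _)

end Column

section Row

/-- The row of a position is its filtration degree. -/
def rowGrading : PageGrading (ℤ × ℤ) where
  shift r := (1 - r, r)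
  fil := AddMonoidHom.snd ℤ ℤ
  deg := AddMonoidHom.fst ℤ ℤ + AddMonoidHom.snd ℤ ℤ
  fil_shift _ := rfl
  deg_shift r := by simp

/-- The total complex with the filtration by rows. -/
noncomputable abbrev rowFiltered : FilteredComplex.{u, v} k := M.filteredTotal OrderHom.snd

lemma isGrEquiv_row (i j n : ℤ) (h : i + j = n) :
    M.rowFiltered.IsGrEquiv j (M.ιTotal i j n h) :=
  isGrEquiv_ιTotal h fun x hx => by
    rw [Prod.ext_iff]
    exact ⟨fun (hj : x.2 = j) => ⟨by lia, hj⟩, And.right⟩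

/-- The associated graded complex of the row filtration is the row `(M^{•,j}, ∂₁)`. -/
noncomputable def rowChart (i j : ℤ) : M.rowFiltered.GradedChart (M.sc₁ i j) j (i + j) where
  ι₁ := M.ιTotal (i - 1) j (i + j - 1) (by lia)
  ι₂ := M.ιTotal i j (i + j) rfl
  ι₃ := M.ιTotal (i + 1) j (i + j + 1) (by lia)
  isGrEquiv₁ := M.isGrEquiv_row _ _ _ _
  isGrEquiv₂ := M.isGrEquiv_row _ _ _ _
  isGrEquiv₃ := M.isGrEquiv_row _ _ _ _
  d_ι₁_sub_mem :=
    total_d_ιTotal_sub_d₁_mem (sub_add_cancel i 1) rfl _ (sub_add_cancel _ 1) (le_refl (j + 1))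
  d_ι₂_sub_mem := total_d_ιTotal_sub_d₁_mem rfl rfl _ rfl (le_refl (j + 1))

/-- `E_1^{i,j} ≅ H^{i,j}(M, ∂₁)`. -/
noncomputable def rowPageIso (i j : ℤ) :
    (M.rowFiltered.page rowGrading 1).X (i, j) ≅ M.H₁ i j :=
  FilteredComplex.GradedChart.pageIso (P := rowGrading) (x := (i, j)) (M.rowChart i j)

lemma page_d_comp_rowPageIso_hom (i j : ℤ) :
    (M.rowFiltered.page rowGrading 1).d (i, j) (i, j + 1) ≫
      (M.rowPageIso i (j + 1)).hom = (M.rowPageIso i j).hom ≫ M.inducedD₂ i j := by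
  have h : (i, j) + rowGrading.shift 1 = (i, j + 1) := Prod.ext (add_zero i) rfl
  refine FilteredComplex.GradedChart.page_d_comp_pageIso_hom h (M.rowChart i j)
    (M.rowChart i (j + 1)) (M.sc₁Map i j) fun (m : M.X i j)
      (hm : M.d₁ i (i + 1) j rfl m = 0) => ?_
  have d_ι : M.total.d _ _ (M.ιTotal i j (i + j) rfl m) =
      M.ιTotal i (j + 1) (i + (j + 1)) rfl (M.d₂ i j (j + 1) rfl m) := by
    rw [total_d_ιTotal rfl rfl _ (by lia), hm, map_zero, zero_add]
  exact congr($(sub_eq_zero.2 d_ι) ∈ _).mpr (zero_mem _)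

end Row

variable {M}

lemma BoundedFromSoutheast.exists_subsingleton (h : M.BoundedFromSoutheast) (n : ℤ) :
    ∃ p, ∀ i j, i + j = n → p ≤ i → Subsingleton (M.X i j) := by
  obtain ⟨a, b, h⟩ := h
  exact ⟨max a (n - b), fun i j hn hp => h i j (by lia) (by lia)⟩

lemma BoundedFromNorthwest.exists_subsingleton (h : M.BoundedFromNorthwest) (n : ℤ) :
    ∃ p, ∀ i j, i + j = n → p ≤ j → Subsingleton (M.X i j) := by
  obtain ⟨a, b, h⟩ := h
  exact ⟨max b (n - a), fun i j hn hp => h i j (by lia) (by lia)⟩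

end Bicomplex

theorem mainTheorem6_general {k : Type u} [Field k] (M : Bicomplex.{u, v} k) :
    ((∀ n, ∃ p, ∀ i j, i + j = n → p ≤ i → Subsingleton (M.X i j)) →
      ∃ (E : SpectralSequence (ModuleCat.{v} k)
          (fun r : ℤ => ComplexShape.up' ((r, 1 - r) : ℤ × ℤ)) 1)
        (e : ∀ i j : ℤ, (E.page 1 le_rfl).X (i, j) ≅ M.H₂ i j),
        (∀ i j : ℤ, (E.page 1 le_rfl).d (i, j) (i + 1, j) ≫ (e (i + 1) j).hom =
          (e i j).hom ≫ M.inducedD₁ i j) ∧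
        SpecSeq.ConvergesTo E (fun x => x.1) (fun x => x.1 + x.2)
          M.totalCohomology M.columnFiltration) ∧
    ((∀ n, ∃ p, ∀ i j, i + j = n → p ≤ j → Subsingleton (M.X i j)) →
      ∃ (E : SpectralSequence (ModuleCat.{v} k)
          (fun r : ℤ => ComplexShape.up' ((1 - r, r) : ℤ × ℤ)) 1)
        (e : ∀ i j : ℤ, (E.page 1 le_rfl).X (i, j) ≅ M.H₁ i j),
        (∀ i j : ℤ, (E.page 1 le_rfl).d (i, j) (i, j + 1) ≫ (e i (j + 1)).hom =
          (e i j).hom ≫ M.inducedD₂ i j) ∧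
        SpecSeq.ConvergesTo E (fun x => x.2) (fun x => x.1 + x.2)
          M.totalCohomology M.rowFiltration) := by
  refine ⟨fun h => ⟨M.columnFiltered.spectralSequence Bicomplex.columnGrading 1, M.columnPageIso,
      M.page_d_comp_columnPageIso_hom, ?_⟩,
    fun h => ⟨M.rowFiltered.spectralSequence Bicomplex.rowGrading 1, M.rowPageIso,
      M.page_d_comp_rowPageIso_hom, ?_⟩⟩
  · exact FilteredComplex.spectralSequence_convergesTo Bicomplex.exists_mem_filteredTotal_F
      fun n => (h n).imp fun _ hp => Bicomplex.filteredTotal_F_eq_bot hp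
  · exact FilteredComplex.spectralSequence_convergesTo Bicomplex.exists_mem_filteredTotal_F
      fun n => (h n).imp fun _ hp => Bicomplex.filteredTotal_F_eq_bot hp

theorem mainTheorem6 {k : Type u} [Field k] (M : Bicomplex.{u, v} k) :
    (M.BoundedFromSoutheast →
      ∃ (E : SpectralSequence (ModuleCat.{v} k)
          (fun r : ℤ => ComplexShape.up' ((r, 1 - r) : ℤ × ℤ)) 1)
        (e : ∀ i j : ℤ, (E.page 1 le_rfl).X (i, j) ≅ M.H₂ i j),
        (∀ i j : ℤ, (E.page 1 le_rfl).d (i, j) (i + 1, j) ≫ (e (i + 1) j).hom =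
          (e i j).hom ≫ M.inducedD₁ i j) ∧
        SpecSeq.ConvergesTo E (fun x => x.1) (fun x => x.1 + x.2)
          M.totalCohomology M.columnFiltration) ∧
    (M.BoundedFromNorthwest →
      ∃ (E : SpectralSequence (ModuleCat.{v} k)
          (fun r : ℤ => ComplexShape.up' ((1 - r, r) : ℤ × ℤ)) 1)
        (e : ∀ i j : ℤ, (E.page 1 le_rfl).X (i, j) ≅ M.H₁ i j),
        (∀ i j : ℤ, (E.page 1 le_rfl).d (i, j) (i, j + 1) ≫ (e i (j + 1)).hom =
          (e i j).hom ≫ M.inducedD₂ i j) ∧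
        SpecSeq.ConvergesTo E (fun x => x.2) (fun x => x.1 + x.2)
          M.totalCohomology M.rowFiltration) :=
  ⟨fun h => (mainTheorem6_general M).1 h.exists_subsingleton,
    fun h => (mainTheorem6_general M).2 h.exists_subsingleton⟩
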